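/- Let $\mathfrak g$ be a finite-dimensional simple Lie algebra over $\mathbb C$ with triangular decomposition $\mathfrak g=\mathfrak n_-\oplus\mathfrak h\oplus\mathfrak n_+$ ($\mathfrak h$ a Cartan subalgebra, $\mathfrak n_+$ the sum of the positive root spaces with respect to a base of the root system), and let $(\cdot|\cdot)$ be its Killing form. Let $\tilde{\mathfrak g}=\mathfrak g\otimes\mathbb C[t,t^{-1}]\oplus\mathbb CK\oplus\mathbb Cd$ be the untwisted affine Kac–Moody algebra, in which $K$ is central, $$[x\otimes t^k,y\otimes t^n]=[x,y]\otimes t^{k+n}+k\,\delta_{k+n,0}\,(x|y)K,\qquad [d,x\otimes t^n]=n\,x\otimes t^n,$$ and let $\hat{\mathfrak g}=\mathfrak g\otimes\mathbb C[t,t^{-1}]\oplus\mathbb CK$. For $a=(a_1,\dots,a_m)\in\mathbb C^m$ with nonzero, pairwise distinct entries and $\lambda=(\lambda_1,\dots,\lambda_m)\in(\mathfrak h^*)^m$, let $V(\lambda_i)$ be the irreducible highest weight $\mathfrak g$-module of highest weight $\lambda_i$ (irreducible and generated by a nonzero vector $v$ with $\mathfrak n_+v=0$ and $hv=\lambda_i(h)v$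 for $h\in\mathfrak h$), and let $E(\lambda,a)=V(\lambda_1)\otimes\cdots\otimes V(\lambda_m)$ be the evaluation module over $\hat{\mathfrak g}$, on which $K$ acts as $0$ and $$(x\otimes t^k)(v_1\otimes\cdots\otimes v_m)=\sum_{i=1}^m a_i^k\,v_1\otimes\cdots\otimes xv_i\otimes\cdots\otimes v_m .$$ If $\lambda\neq0$ (that is, $\lambda_i\ne 0$ for some $i$), then the induced module $E(\lambda,a)[d]=\operatorname{Ind}_{\hat{\mathfrak g}}^{\tilde{\mathfrak g}}E(\lambda,a)=U(\tilde{\mathfrak g})\otimes_{U(\hat{\mathfrak g})}E(\lambda,a)$ is an irreducible $\tilde{\mathfrak g}$-module. -/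

import Mathlib

open scoped TensorProduct

universe u v

noncomputable section

/-! ## The untwisted affine Kac-Moody algebra -/

namespace AffineKM

variable (g : Type u) [LieRing g] [LieAlgebra ℂ g]

/-- The loop algebra `g ⊗ ℂ[t, t⁻¹]` (the coefficient factor is written on the left). -/
def Loop : Type u := LieAlgebra.loopAlgebra ℂ ℤ g

instance : LieRing (Loop g) := inferInstanceAs (LieRing (LieAlgebra.loopAlgebra ℂ ℤ g))

instance : LieAlgebra ℂ (Loop g) := inferInstanceAs (LieAlgebra ℂ (LieAlgebra.loopAlgebra ℂ ℤ g))

variable {g} in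
/-- The element `x ⊗ t ^ n` of the loop algebra. -/
def loopMono (x : g) (n : ℤ) : Loop g :=
  (AddMonoidAlgebra.single n (1 : ℂ) ⊗ₜ[ℂ] x : LieAlgebra.loopAlgebra ℂ ℤ g)

variable {g} in
/-- The elements `x ⊗ t ^ n` generate the loop algebra additively. -/
theorem loop_induction {p : Loop g → Prop} (z : Loop g) (h0 : p 0)
    (hmono : ∀ x n, p (loopMono x n)) (hadd : ∀ y z, p y → p z → p (y + z)) : p z := by
  refine TensorProduct.induction_on (motive := p) z h0 (fun f x => ?_) hadd
  induction f using AddMonoidAlgebra.induction_linear with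
  | zero => rwa [TensorProduct.zero_tmul]
  | add f f' hf hf' => rw [TensorProduct.add_tmul]; exact hadd _ _ hf hf'
  | single n c =>
    have : (AddMonoidAlgebra.single n c : AddMonoidAlgebra ℂ ℤ) ⊗ₜ[ℂ] x = loopMono (c • x) n := by
      rw [loopMono, ← TensorProduct.smul_tmul, AddMonoidAlgebra.smul_single, smul_eq_mul, mul_one]
    rw [this]
    exact hmono _ _

variable {g} in
theorem loopMono_lie (x y : g) (m n : ℤ) :
    ⁅loopMono x m, loopMono y n⁆ = loopMono ⁅x, y⁆ (m + n) := by
  refine (LieAlgebra.ExtendScalars.bracket_tmul ℂ (AddMonoidAlgebra ℂ ℤ) g g _ _ x y).trans ?_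
  rw [AddMonoidAlgebra.single_mul_single, mul_one, loopMono]

/-- The degree operator `t d/dt` on Laurent polynomials. -/
def laurentDegree : AddMonoidAlgebra ℂ ℤ →ₗ[ℂ] AddMonoidAlgebra ℂ ℤ :=
  (AddMonoidAlgebra.basis ℤ ℂ).constr ℂ fun n => (n : ℂ) • AddMonoidAlgebra.single n (1 : ℂ)

/-- The degree derivation `d = t d/dt` of the loop algebra, `x ⊗ t ^ n ↦ n x ⊗ t ^ n`. -/
def loopDegree : Loop g →ₗ[ℂ] Loop g :=
  (LinearMap.rTensor g laurentDegree :
    LieAlgebra.loopAlgebra ℂ ℤ g →ₗ[ℂ] LieAlgebra.loopAlgebra ℂ ℤ g)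

variable {g} in
theorem loopDegree_mono (x : g) (n : ℤ) :
    loopDegree g (loopMono x n) = (n : ℂ) • loopMono x n := by
  have : laurentDegree (AddMonoidAlgebra.single n (1 : ℂ))
      = (n : ℂ) • AddMonoidAlgebra.single n (1 : ℂ) :=
    (AddMonoidAlgebra.basis ℤ ℂ).constr_basis ℂ _ n
  refine (LinearMap.rTensor_tmul g laurentDegree x _).trans ?_
  rw [this]
  rfl

variable {g} in
theorem loopDegree_lie (x y : Loop g) :
    loopDegree g ⁅x, y⁆ = ⁅loopDegree g x, y⁆ + ⁅x, loopDegree g y⁆ := by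
  induction x using loop_induction with
  | h0 => simp
  | hadd x x' hx hx' => rw [add_lie, map_add, hx, hx', map_add, add_lie, add_lie]; abel
  | hmono x m =>
    induction y using loop_induction with
    | h0 => simp
    | hadd y y' hy hy' => rw [lie_add, map_add, hy, hy', map_add, lie_add, lie_add]; abel
    | hmono y n =>
      rw [loopMono_lie, loopDegree_mono, loopDegree_mono, loopDegree_mono, smul_lie, lie_smul,
        loopMono_lie, ← add_smul]
      push_cast
      rfl

/-- The two-cocycle `ω (x ⊗ t ^ m, y ⊗ t ^ n) = m δ_{m + n, 0} (x | y)` on the loop algebra,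
where `(x | y)` is the Killing form of `g`. Mathlib's residue pairing puts the exponent of its
second argument in front, hence the swap. -/
def loopCocycle : Loop g →ₗ[ℂ] Loop g →ₗ[ℂ] ℂ :=
  (LieAlgebra.LoopAlgebra.residuePairing ℂ ℤ g (killingForm ℂ g)).flip

variable {g}

theorem loopCocycle_apply (x y : Loop g) :
    loopCocycle g x y = LieAlgebra.LoopAlgebra.residuePairing ℂ ℤ g (killingForm ℂ g) y x := rfl

theorem loopCocycle_mono (x y : g) (m n : ℤ) :
    loopCocycle g (loopMono x m) (loopMono y n)
      = if m + n = 0 then (m : ℂ) * killingForm ℂ g x y else 0 := by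
  have key : LieAlgebra.LoopAlgebra.residuePairing ℂ ℤ g (killingForm ℂ g)
      (AddMonoidAlgebra.single n 1 ⊗ₜ[ℂ] y) (AddMonoidAlgebra.single m 1 ⊗ₜ[ℂ] x)
      = if m + n = 0 then (m : ℂ) * killingForm ℂ g x y else 0 := by
    rw [LieAlgebra.LoopAlgebra.residuePairing_apply_apply,
      LieAlgebra.LoopAlgebra.toFinsupp_single_tmul, LieAlgebra.LoopAlgebra.toFinsupp_single_tmul,
      Finsupp.sum_single_index (by simp), zsmul_eq_mul]
    split_ifs with h
    · have : n = -m := by omega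
      subst this
      rw [Finsupp.single_eq_same, LieModule.traceForm_comm]
    · rw [Finsupp.single_eq_of_ne (by omega), map_zero, LinearMap.zero_apply, mul_zero]
  exact key

theorem loopCocycle_skew (x y : Loop g) : loopCocycle g x y = - loopCocycle g y x := by
  induction x using loop_induction with
  | h0 => simp
  | hadd x x' hx hx' => rw [map_add, map_add, LinearMap.add_apply, hx, hx']; ring
  | hmono x m =>
    induction y using loop_induction with
    | h0 => simp
    | hadd y y' hy hy' => rw [map_add, map_add, LinearMap.add_apply, hy, hy']; ring
    | hmono y n =>
      rw [loopCocycle_mono, loopCocycle_mono]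
      by_cases h : m + n = 0
      · have : n = -m := by omega
        subst this
        rw [LieModule.traceForm_comm ℂ g g y x]
        simp
      · rw [if_neg h, if_neg (by omega), neg_zero]

theorem loopCocycle_self (x : Loop g) : loopCocycle g x x = 0 := by
  have := loopCocycle_skew x x
  linear_combination this / 2

theorem loopCocycle_degree (x y : Loop g) :
    loopCocycle g (loopDegree g x) y + loopCocycle g x (loopDegree g y) = 0 := by
  induction x using loop_induction with
  | h0 => simp
  | hadd x x' hx hx' =>
    rw [map_add, map_add, map_add, LinearMap.add_apply, LinearMap.add_apply]
    linear_combination hx + hx'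
  | hmono x m =>
    induction y using loop_induction with
    | h0 => simp
    | hadd y y' hy hy' =>
      rw [map_add, map_add, map_add]
      linear_combination hy + hy'
    | hmono y n =>
      rw [loopDegree_mono, loopDegree_mono, map_smul, map_smul, LinearMap.smul_apply,
        loopCocycle_mono, smul_eq_mul, smul_eq_mul]
      split_ifs with h
      · have : n = -m := by omega
        subst this
        push_cast
        ring
      · ring

theorem loopCocycle_lie (x y z : Loop g) :
    loopCocycle g x ⁅y, z⁆ = loopCocycle g ⁅x, y⁆ z + loopCocycle g y ⁅x, z⁆ := by
  have h := (LieAlgebra.LoopAlgebra.twoCocycleOfBilinear ℂ ℤ g (killingForm ℂ g)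
    (LieModule.traceForm_lieInvariant ℂ g g) ⟨LieModule.traceForm_comm ℂ g g⟩).2
  rw [LieModule.Cohomology.mem_twoCocycle_iff_of_trivial] at h
  have h' : loopCocycle g ⁅y, z⁆ x = loopCocycle g z ⁅x, y⁆ + loopCocycle g ⁅x, z⁆ y := h x y z
  rw [loopCocycle_skew _ x, loopCocycle_skew z, loopCocycle_skew _ y] at h'
  linear_combination -h'

end AffineKM

open AffineKM

/-- The untwisted affine Kac-Moody algebra `g ⊗ ℂ[t, t⁻¹] ⊕ ℂ K ⊕ ℂ d` of `g`. The triple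
`(f, a, s)` stands for `f + a K + s d`. -/
def AffineAlgebra (g : Type u) [LieRing g] [LieAlgebra ℂ g] : Type u := Loop g × ℂ × ℂ

namespace AffineAlgebra

variable {g : Type u} [LieRing g] [LieAlgebra ℂ g]

instance : AddCommGroup (AffineAlgebra g) := inferInstanceAs (AddCommGroup (Loop g × ℂ × ℂ))

instance : Module ℂ (AffineAlgebra g) := inferInstanceAs (Module ℂ (Loop g × ℂ × ℂ))

/-- The coefficient of a vector in the loop algebra. -/
def loopPart : AffineAlgebra g →ₗ[ℂ] Loop g := LinearMap.fst ℂ (Loop g) (ℂ × ℂ)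

/-- The coefficient at the central element `K`. -/
def centralCoeff : AffineAlgebra g →ₗ[ℂ] ℂ :=
  LinearMap.fst ℂ ℂ ℂ ∘ₗ LinearMap.snd ℂ (Loop g) (ℂ × ℂ)

/-- The coefficient at the degree derivation `d`. -/
def degreeCoeff : AffineAlgebra g →ₗ[ℂ] ℂ :=
  LinearMap.snd ℂ ℂ ℂ ∘ₗ LinearMap.snd ℂ (Loop g) (ℂ × ℂ)

@[ext]
theorem ext {x y : AffineAlgebra g} (h₁ : loopPart x = loopPart y)
    (h₂ : centralCoeff x = centralCoeff y) (h₃ : degreeCoeff x = degreeCoeff y) : x = y :=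
  Prod.ext h₁ (Prod.ext h₂ h₃)

/-- The inclusion of the loop algebra (as a vector space). -/
def ofLoop : Loop g →ₗ[ℂ] AffineAlgebra g := LinearMap.inl ℂ (Loop g) (ℂ × ℂ)

variable (g) in
/-- The central element `K`. -/
def K : AffineAlgebra g := ((0, 1, 0) : Loop g × ℂ × ℂ)

variable (g) in
/-- The degree derivation `d`. -/
def d : AffineAlgebra g := ((0, 0, 1) : Loop g × ℂ × ℂ)

/-- `[f + a K + s d, f' + a' K + s' d] = [f, f'] + s t(df'/dt) - s' t(df/dt) + ω(f, f') K`. -/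
instance : Bracket (AffineAlgebra g) (AffineAlgebra g) where
  bracket x y :=
    ((⁅loopPart x, loopPart y⁆ + degreeCoeff x • loopDegree g (loopPart y)
        - degreeCoeff y • loopDegree g (loopPart x),
      loopCocycle g (loopPart x) (loopPart y), 0) : Loop g × ℂ × ℂ)

theorem loopPart_lie (x y : AffineAlgebra g) :
    loopPart ⁅x, y⁆ = ⁅loopPart x, loopPart y⁆ + degreeCoeff x • loopDegree g (loopPart y)
      - degreeCoeff y • loopDegree g (loopPart x) := rfl

theorem centralCoeff_lie (x y : AffineAlgebra g) :
    centralCoeff ⁅x, y⁆ = loopCocycle g (loopPart x) (loopPart y) := rfl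

theorem degreeCoeff_lie (x y : AffineAlgebra g) : degreeCoeff ⁅x, y⁆ = 0 := rfl

theorem leibniz_loop (x y z : Loop g) (p q r : ℂ) :
    ⁅x, ⁅y, z⁆ + q • loopDegree g z - r • loopDegree g y⁆
        + p • loopDegree g (⁅y, z⁆ + q • loopDegree g z - r • loopDegree g y)
        - (0 : ℂ) • loopDegree g x
      = (⁅⁅x, y⁆ + p • loopDegree g y - q • loopDegree g x, z⁆ + (0 : ℂ) • loopDegree g z
          - r • loopDegree g (⁅x, y⁆ + p • loopDegree g y - q • loopDegree g x))
        + (⁅y, ⁅x, z⁆ + p • loopDegree g z - r • loopDegree g x⁆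
          + q • loopDegree g (⁅x, z⁆ + p • loopDegree g z - r • loopDegree g x)
          - (0 : ℂ) • loopDegree g y) := by
  simp only [map_add, map_sub, map_smul, lie_add, lie_sub, add_lie, sub_lie, loopDegree_lie,
    lie_smul, smul_lie]
  rw [leibniz_lie x, ← lie_skew (loopDegree g x) y]
  module

theorem leibniz_central (x y z : Loop g) (p q r : ℂ) :
    loopCocycle g x (⁅y, z⁆ + q • loopDegree g z - r • loopDegree g y)
      = loopCocycle g (⁅x, y⁆ + p • loopDegree g y - q • loopDegree g x) z
        + loopCocycle g y (⁅x, z⁆ + p • loopDegree g z - r • loopDegree g x) := by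
  simp only [map_add, map_sub, map_smul, LinearMap.add_apply, LinearMap.sub_apply,
    LinearMap.smul_apply, smul_eq_mul]
  have h₁ := loopCocycle_lie x y z
  have h₂ := loopCocycle_degree x z
  have h₃ := loopCocycle_degree x y
  have h₄ := loopCocycle_degree y z
  have h₅ := loopCocycle_skew (loopDegree g x) y
  linear_combination h₁ + q * h₂ - r * h₃ - p * h₄ + r * h₅

instance : LieRing (AffineAlgebra g) where
  add_lie x y z := by
    ext
    · simp only [loopPart_lie, map_add, add_lie, add_smul, smul_add]; abel
    · simp only [centralCoeff_lie, map_add, LinearMap.add_apply]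
    · simp only [degreeCoeff_lie, map_add, add_zero]
  lie_add x y z := by
    ext
    · simp only [loopPart_lie, map_add, lie_add, add_smul, smul_add]; abel
    · simp only [centralCoeff_lie, map_add]
    · simp only [degreeCoeff_lie, map_add, add_zero]
  lie_self x := by
    ext
    · rw [loopPart_lie, lie_self, zero_add, sub_self, map_zero]
    · rw [centralCoeff_lie, loopCocycle_self, map_zero]
    · rw [degreeCoeff_lie, map_zero]
  leibniz_lie x y z := by
    ext
    · exact leibniz_loop _ _ _ _ _ _
    · exact leibniz_central _ _ _ _ _ _
    · exact (add_zero (0 : ℂ)).symm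

instance : LieAlgebra ℂ (AffineAlgebra g) where
  lie_smul c x y := by
    ext
    · simp only [loopPart_lie, map_smul, lie_smul, smul_sub, smul_add, smul_eq_mul, mul_smul,
        smul_comm (degreeCoeff x) c]
    · simp only [centralCoeff_lie, map_smul]
    · simp only [degreeCoeff_lie, map_smul, smul_zero]

/-- `[x ⊗ t ^ m, y ⊗ t ^ n] = [x, y] ⊗ t ^ (m + n) + m δ_{m + n, 0} (x | y) K`. -/
theorem lie_mono_mono (x y : g) (m n : ℤ) :
    ⁅ofLoop (loopMono x m), ofLoop (loopMono y n)⁆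
      = ofLoop (loopMono ⁅x, y⁆ (m + n))
        + (if m + n = 0 then (m : ℂ) * killingForm ℂ g x y else 0) • K g := by
  rw [← loopMono_lie, ← loopCocycle_mono]
  refine Prod.ext ?_ (Prod.ext ?_ ?_)
  · change ⁅loopMono x m, loopMono y n⁆ + (0 : ℂ) • loopDegree g (loopMono y n)
      - (0 : ℂ) • loopDegree g (loopMono x m) = ⁅loopMono x m, loopMono y n⁆ + _ • (0 : Loop g)
    simp
  · change loopCocycle g (loopMono x m) (loopMono y n) = (0 : ℂ) + _ * 1
    rw [mul_one, zero_add]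
  · change (0 : ℂ) = 0 + _ * 0
    simp

/-- `[d, x ⊗ t ^ m] = m x ⊗ t ^ m`. -/
theorem lie_d_mono (x : g) (m : ℤ) :
    ⁅d g, ofLoop (loopMono x m)⁆ = (m : ℂ) • ofLoop (loopMono x m) := by
  rw [← map_smul, ← loopDegree_mono]
  refine Prod.ext ?_ (Prod.ext ?_ rfl)
  · change ⁅(0 : Loop g), _⁆ + (1 : ℂ) • loopDegree g (loopMono x m) - (0 : ℂ) • _
      = loopDegree g (loopMono x m)
    simp
  · change loopCocycle g 0 _ = 0
    simp

/-- `K` is central. -/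
theorem lie_K (x : AffineAlgebra g) : ⁅K g, x⁆ = 0 := by
  refine Prod.ext ?_ (Prod.ext ?_ rfl)
  · change ⁅(0 : Loop g), _⁆ + (0 : ℂ) • _ - _ • loopDegree g 0 = 0
    simp
  · change loopCocycle g 0 _ = 0
    simp

variable (g) in
/-- The Lie subalgebra `g ⊗ ℂ[t, t⁻¹] ⊕ ℂ K`. -/
def hat : LieSubalgebra ℂ (AffineAlgebra g) where
  toSubmodule := LinearMap.ker degreeCoeff
  lie_mem' {x y} _ _ := degreeCoeff_lie x y

end AffineAlgebra

/-! ## Evaluation modules -/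

namespace AffineKM

attribute [local instance 100] LieRing.ofAssociativeRing

variable {g : Type u} [LieRing g] [LieAlgebra ℂ g]

/-- Evaluation of Laurent polynomials at a nonzero complex number. -/
def laurentEval (a : ℂˣ) : AddMonoidAlgebra ℂ ℤ →ₐ[ℂ] ℂ :=
  AddMonoidAlgebra.lift ℂ ℂ ℤ ((Units.coeHom ℂ).comp (zpowersHom ℂˣ a))

theorem laurentEval_single (a : ℂˣ) (n : ℤ) :
    laurentEval a (AddMonoidAlgebra.single n 1) = (a : ℂ) ^ n := by
  rw [laurentEval, AddMonoidAlgebra.lift_single, one_smul]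
  simp

/-- The evaluation map `x ⊗ t ^ n ↦ a ^ n x` from the loop algebra to `g`. -/
def loopEval (a : ℂˣ) : Loop g →ₗ[ℂ] g :=
  ((TensorProduct.lid ℂ g).toLinearMap ∘ₗ LinearMap.rTensor g (laurentEval a).toLinearMap :
    LieAlgebra.loopAlgebra ℂ ℤ g →ₗ[ℂ] g)

theorem loopEval_mono (a : ℂˣ) (x : g) (n : ℤ) :
    loopEval a (loopMono x n) = ((a : ℂ) ^ n) • x := by
  have : loopEval a (loopMono x n) = laurentEval a (AddMonoidAlgebra.single n 1) • x := rfl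
  rw [this, laurentEval_single]

theorem loopEval_lie (a : ℂˣ) (x y : Loop g) : loopEval a ⁅x, y⁆ = ⁅loopEval a x, loopEval a y⁆ := by
  induction x using loop_induction with
  | h0 => simp
  | hadd x x' hx hx' => rw [add_lie, map_add, hx, hx', map_add, add_lie]
  | hmono x m =>
    induction y using loop_induction with
    | h0 => simp
    | hadd y y' hy hy' => rw [lie_add, map_add, hy, hy', map_add, lie_add]
    | hmono y n =>
      rw [loopMono_lie, loopEval_mono, loopEval_mono, loopEval_mono, smul_lie, lie_smul, smul_smul,
        zpow_add₀ a.ne_zero]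

variable {m : ℕ} (V : Fin m → Type v) [∀ i, AddCommGroup (V i)] [∀ i, Module ℂ (V i)]

/-- An operator on the `i`-th factor, acting on `V 1 ⊗ ... ⊗ V m`. -/
def siteOp (i : Fin m) : Module.End ℂ (V i) →ₗ[ℂ] Module.End ℂ (⨂[ℂ] j, V j) :=
  (PiTensorProduct.mapMultilinear ℂ V V).toLinearMap (fun _ => LinearMap.id) i

theorem siteOp_tprod (i : Fin m) (f : Module.End ℂ (V i)) (v : ∀ j, V j) :
    siteOp V i f (PiTensorProduct.tprod ℂ v)
      = PiTensorProduct.tprod ℂ (Function.update v i (f (v i))) := by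
  change PiTensorProduct.map (Function.update (fun _ => LinearMap.id) i f) _ = _
  rw [PiTensorProduct.map_tprod]
  congr 1
  ext j
  rcases eq_or_ne j i with rfl | h
  · simp
  · simp [h]

theorem siteOp_mul (i : Fin m) (f f' : Module.End ℂ (V i)) :
    siteOp V i (f * f') = siteOp V i f * siteOp V i f' := by
  apply PiTensorProduct.ext
  ext v
  simp [siteOp_tprod]

theorem siteOp_comm {i j : Fin m} (h : i ≠ j) (f : Module.End ℂ (V i)) (f' : Module.End ℂ (V j)) :
    siteOp V i f * siteOp V j f' = siteOp V j f' * siteOp V i f := by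
  apply PiTensorProduct.ext
  ext v
  simp [siteOp_tprod, h, h.symm, Function.update_comm h]

variable [∀ i, LieRingModule g (V i)] [∀ i, LieModule ℂ g (V i)]

/-- The operator by which a vector of `g ⊗ ℂ[t, t⁻¹] ⊕ ℂ K` acts on `V 1 ⊗ ... ⊗ V m`:
`x ⊗ t ^ n` acts as the sum over `i` of `a i ^ n` times the action of `x` on the `i`-th factor,
and `K` acts as zero. -/
def evalOp (a : Fin m → ℂˣ) : AffineAlgebra.hat g →ₗ[ℂ] Module.End ℂ (⨂[ℂ] j, V j) :=
  ∑ i, siteOp V i ∘ₗ (LieModule.toEnd ℂ g (V i)).toLinearMap ∘ₗ loopEval (a i) ∘ₗ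
    AffineAlgebra.loopPart ∘ₗ (AffineAlgebra.hat g).toSubmodule.subtype

variable (a : Fin m → ℂˣ)

theorem evalOp_apply (x : AffineAlgebra.hat g) :
    evalOp V a x = ∑ i, siteOp V i
      (LieModule.toEnd ℂ g (V i) (loopEval (a i) (AffineAlgebra.loopPart (x : AffineAlgebra g)))) := by
  simp only [evalOp, LinearMap.sum_apply]
  rfl

theorem evalOp_lie (x y : AffineAlgebra.hat g) :
    evalOp V a ⁅x, y⁆ = evalOp V a x * evalOp V a y - evalOp V a y * evalOp V a x := by
  have hx : AffineAlgebra.degreeCoeff (x : AffineAlgebra g) = 0 := x.2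
  have hy : AffineAlgebra.degreeCoeff (y : AffineAlgebra g) = 0 := y.2
  simp only [evalOp_apply, LieSubalgebra.coe_bracket, AffineAlgebra.loopPart_lie, hx, hy, zero_smul,
    add_zero, sub_zero, loopEval_lie, LieHom.map_lie, Finset.sum_mul_sum]
  rw [Finset.sum_comm (f := fun i j => siteOp V i _ * siteOp V j _), ← Finset.sum_sub_distrib]
  refine Finset.sum_congr rfl fun i _ => ?_
  rw [← Finset.sum_sub_distrib, Finset.sum_eq_single i]
  · rw [Ring.lie_def, map_sub, siteOp_mul, siteOp_mul]
  · intro j _ hj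
    rw [siteOp_comm V hj, sub_self]
  · simp

/-- The underlying space `V 1 ⊗ ... ⊗ V m` of the evaluation module attached to the points
`a 1, ..., a m`. -/
def EvalModule (_a : Fin m → ℂˣ) (V : Fin m → Type v) [∀ i, AddCommGroup (V i)]
    [∀ i, Module ℂ (V i)] : Type v := ⨂[ℂ] i, V i

instance : AddCommGroup (EvalModule a V) := inferInstanceAs (AddCommGroup (⨂[ℂ] i, V i))

instance : Module ℂ (EvalModule a V) := inferInstanceAs (Module ℂ (⨂[ℂ] i, V i))

instance : LieRingModule (AffineAlgebra.hat g) (EvalModule a V) where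
  bracket x w := evalOp V a x w
  add_lie x y w := by
    change evalOp V a (x + y) w = _
    rw [map_add]
    rfl
  lie_add x w w' := map_add (evalOp V a x) w w'
  leibniz_lie x y w := by
    change evalOp V a x (evalOp V a y w) = evalOp V a ⁅x, y⁆ w + evalOp V a y (evalOp V a x w)
    rw [evalOp_lie]
    exact (sub_add_cancel (evalOp V a x (evalOp V a y w)) _).symm

instance : LieModule ℂ (AffineAlgebra.hat g) (EvalModule a V) where
  smul_lie c x w := by
    change evalOp V a (c • x) w = _
    rw [map_smul]
    rfl
  lie_smul c x w := map_smul (evalOp V a x) c w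

/-- The pure tensor `v 1 ⊗ ... ⊗ v m` in the evaluation module. -/
def EvalModule.tprod (v : ∀ i, V i) : EvalModule a V := PiTensorProduct.tprod ℂ v

/-- `(x ⊗ t ^ n) (v 1 ⊗ ... ⊗ v m) = ∑ i, a i ^ n (v 1 ⊗ ... ⊗ x v i ⊗ ... ⊗ v m)`. -/
theorem loopMono_lie_tprod (x : g) (n : ℤ) (v : ∀ i, V i) (s : AffineAlgebra.hat g)
    (hs : (s : AffineAlgebra g) = AffineAlgebra.ofLoop (loopMono x n)) :
    ⁅s, EvalModule.tprod V a v⁆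
      = ∑ i, ((a i : ℂ) ^ n) • EvalModule.tprod V a (Function.update v i ⁅x, v i⁆) := by
  change evalOp V a s (PiTensorProduct.tprod ℂ v) = _
  rw [evalOp_apply, LinearMap.sum_apply, hs]
  refine Finset.sum_congr rfl fun i _ => ?_
  change siteOp V i (LieModule.toEnd ℂ g (V i) (loopEval (a i) (loopMono x n))) _ = _
  rw [loopEval_mono, map_smul, map_smul, LinearMap.smul_apply, siteOp_tprod]
  rfl

/-- `K` acts trivially. -/
theorem K_lie_eval (w : EvalModule a V) (s : AffineAlgebra.hat g)
    (hs : (s : AffineAlgebra g) = AffineAlgebra.K g) : ⁅s, w⁆ = 0 := by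
  have h : evalOp V a s = 0 := by
    rw [evalOp_apply, hs]
    refine Finset.sum_eq_zero fun i _ => ?_
    change siteOp V i (LieModule.toEnd ℂ g (V i) (loopEval (a i) (0 : Loop g))) = 0
    simp
  exact LinearMap.congr_fun h w

end AffineKM

/-! ## Induced modules -/

section Induced

attribute [local instance 100] LieRing.ofAssociativeRing

variable {R : Type*} {L : Type*} {M : Type*} [CommRing R] [LieRing L] [LieAlgebra R L]
  (S : LieSubalgebra R L) [AddCommGroup M] [Module R M] [LieRingModule S M]

variable (M) in
/-- The relations `u s ⊗ w = u ⊗ s w` (`u ∈ U(L)`, `s ∈ S`, `w ∈ M`) in `U(L) ⊗[R] M`, as the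
`U(L)`-submodule generated by the elements `s ⊗ w - 1 ⊗ s w`. Since `S` generates `U(S)`, these
impose `u u' ⊗ w = u ⊗ u' w` for all `u' ∈ U(S)`. -/
def inducedRelations :
    Submodule (UniversalEnvelopingAlgebra R L) (UniversalEnvelopingAlgebra R L ⊗[R] M) :=
  Submodule.span _ {z | ∃ (s : S) (w : M),
    z = UniversalEnvelopingAlgebra.ι R (s : L) ⊗ₜ[R] w - 1 ⊗ₜ[R] ⁅s, w⁆}

variable (M) in
/-- The induced module `Ind_S^L M = U(L) ⊗_{U(S)} M`. -/
def InducedModule : Type _ := (UniversalEnvelopingAlgebra R L ⊗[R] M) ⧸ inducedRelations M S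

namespace InducedModule

instance : AddCommGroup (InducedModule M S) :=
  inferInstanceAs (AddCommGroup (_ ⧸ inducedRelations M S))

instance : Module (UniversalEnvelopingAlgebra R L) (InducedModule M S) :=
  inferInstanceAs (Module _ (_ ⧸ inducedRelations M S))

instance : Module R (InducedModule M S) :=
  inferInstanceAs (Module R (_ ⧸ inducedRelations M S))

instance : IsScalarTower R (UniversalEnvelopingAlgebra R L) (InducedModule M S) :=
  inferInstanceAs (IsScalarTower R _ (_ ⧸ inducedRelations M S))

/-- The class of `u ⊗ w`. -/
def mk (u : UniversalEnvelopingAlgebra R L) (w : M) : InducedModule M S :=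
  (inducedRelations M S).mkQ (u ⊗ₜ[R] w)

/-- `L` acts by left multiplication on `U(L)`. -/
instance : LieRingModule L (InducedModule M S) where
  bracket x z := UniversalEnvelopingAlgebra.ι R x • z
  add_lie x y z := by
    change UniversalEnvelopingAlgebra.ι R (x + y) • z = _
    rw [map_add, add_smul]
  lie_add x z z' := smul_add (UniversalEnvelopingAlgebra.ι R x) z z'
  leibniz_lie x y z := by
    change UniversalEnvelopingAlgebra.ι R x • UniversalEnvelopingAlgebra.ι R y • z
      = UniversalEnvelopingAlgebra.ι R ⁅x, y⁆ • z
        + UniversalEnvelopingAlgebra.ι R y • UniversalEnvelopingAlgebra.ι R x • z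
    rw [LieHom.map_lie, Ring.lie_def, sub_smul, mul_smul, mul_smul, sub_add_cancel]

theorem lie_def (x : L) (z : InducedModule M S) :
    ⁅x, z⁆ = UniversalEnvelopingAlgebra.ι R x • z := rfl

instance : LieModule R L (InducedModule M S) where
  smul_lie c x z := by rw [lie_def, lie_def, map_smul, smul_assoc]
  lie_smul c x z := by rw [lie_def, lie_def, smul_algebra_smul_comm]

theorem lie_mk (x : L) (u : UniversalEnvelopingAlgebra R L) (w : M) :
    ⁅x, mk S u w⁆ = mk S (UniversalEnvelopingAlgebra.ι R x * u) w := rfl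

theorem mk_mul (u : UniversalEnvelopingAlgebra R L) (s : S) (w : M) :
    mk S (u * UniversalEnvelopingAlgebra.ι R (s : L)) w = mk S u ⁅s, w⁆ := by
  have h : u • (UniversalEnvelopingAlgebra.ι R (s : L) ⊗ₜ[R] w - 1 ⊗ₜ[R] ⁅s, w⁆)
      ∈ inducedRelations M S :=
    Submodule.smul_mem _ _ (Submodule.subset_span ⟨s, w, rfl⟩)
  rw [smul_sub, TensorProduct.smul_tmul', TensorProduct.smul_tmul', smul_eq_mul, smul_eq_mul,
    mul_one] at h
  exact (Submodule.Quotient.eq _).2 h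

end InducedModule

end Induced

/-! ## Highest weight modules of a finite-dimensional simple Lie algebra -/

section HighestWeight

variable {g : Type u} [LieRing g] [LieAlgebra ℂ g] [FiniteDimensional ℂ g] [LieAlgebra.IsSimple ℂ g]
  {H : LieSubalgebra ℂ g} [H.IsCartanSubalgebra]

/-- The subalgebra `n₊` of the triangular decomposition `g = n₋ ⊕ H ⊕ n₊` determined by a base of
the root system (as a subspace): the sum of the root spaces of the positive roots. -/
def posNilradical (b : (LieAlgebra.IsKilling.rootSystem H).Base) : Submodule ℂ g :=
  ⨆ (α : H.root) (_ : b.IsPos α), (LieAlgebra.rootSpace H (α : LieModule.Weight ℂ H g)).toSubmodule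

variable (b : (LieAlgebra.IsKilling.rootSystem H).Base) (lam : Module.Dual ℂ H)
  (V : Type v) [AddCommGroup V] [Module ℂ V] [LieRingModule g V] [LieModule ℂ g V]

variable {V} in
/-- `v` is a highest weight vector of weight `lam`. -/
structure IsHighestWeightVector (v : V) : Prop where
  ne_zero : v ≠ 0
  weight : ∀ h : H, ⁅(h : g), v⁆ = lam h • v
  pos : ∀ x ∈ posNilradical b, ⁅x, v⁆ = 0

/-- `V` is a highest weight module of highest weight `lam`: it is generated by a highest weight
vector of weight `lam`. -/
def IsHighestWeightModule : Prop :=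
  ∃ v : V, IsHighestWeightVector b lam v ∧ LieSubmodule.lieSpan ℂ g {v} = ⊤

/-- `V` is (a model of) the irreducible highest weight module `V(lam)`. -/
structure IsIrreducibleHighestWeightModule : Prop where
  irreducible : LieModule.IsIrreducible ℂ g V
  highestWeight : IsHighestWeightModule b lam V

end HighestWeight

end

/-! Every element of the induced module is a sum of terms `d ^ k ⊗ w`, and `(x ⊗ t ^ n) d = (d - n)
(x ⊗ t ^ n)`. Hence, for a polynomial `f`, the element `x ⊗ f` sends `p(d) ⊗ w` to the sum over `i`
of `(f(a i S) p)(d) ⊗ x_i w`, where `S p(X) = p(X - 1)` and `x_i` is `x` acting on the `i`-th factor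
(`polyLoop_lie_polyMk`). On polynomials of degree at most `K`, the operator `a l S` is `a l` times a
unipotent one. Since the `a l` are distinct and nonzero, a suitable `f` kills every site except the
`i`-th, and there extracts the coefficient of degree `K` (`exists_aeval_smul_polyShift`).

So a submodule containing `∑ d ^ k ⊗ w k` with top degree `K` contains `1 ⊗ x_i (w K)` for all `i`
and `x` (`polyMk_one_siteAction_mem`). As `lam ≠ 0`, one of these vectors is nonzero when `w K ≠ 0`,
so a nonzero submodule meets `1 ⊗ E` nontrivially. The case `K = 0` shows that the intersection is
stable under `g` acting on each factor separately. An outer tensor product of irreducibles is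
irreducible (`IsSiteStable.eq_top`), so all of `1 ⊗ E` is reached, and it generates. The factors may
be infinite-dimensional: Schur's lemma comes from countable dimension over the uncountable field
`ℂ`, and Jacobson density does the rest.

That the induced module is nonzero is seen without a PBW theorem, from an explicit action on
functions `ℤ → E` in which `E` sits as the constants (`polyMk_one_injective`). -/

noncomputable section

/-! ### Schur's lemma in countable dimension, and density -/

section Density

/-- Dixmier's argument: if `φ` were not scalar, every `φ - c` would be invertible by Schur, and the
vectors `(φ - c)⁻¹ v`, one for each complex `c`, would be linearly independent, which exceeds a
countable dimension. -/
theorem linearMap_eq_smul_of_countable_span {R : Type*} {M : Type*} [Ring R] [AddCommGroup M]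
    [Algebra ℂ R] [Module ℂ M] [Module R M] [IsScalarTower ℂ R M] [IsSimpleModule R M]
    {s : Set M} (hs : s.Countable) (hspan : Submodule.span ℂ s = ⊤) (φ : M →ₗ[R] M) :
    ∃ c : ℂ, ∀ w, φ w = c • w := by
  by_contra! hφ
  have : Nontrivial M := IsSimpleModule.nontrivial R M
  obtain ⟨v, hv⟩ := exists_ne (0 : M)
  let ψ : Module.End ℂ M := φ.restrictScalars ℂ
  let τ (c : ℂ) : M →ₗ[R] M :=
    { toFun := fun w => φ w - c • w
      map_add' := fun x y => by rw [map_add, smul_add]; abel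
      map_smul' := fun r x => by
        rw [map_smul, RingHom.id_apply, smul_sub, smul_algebra_smul_comm c r x] }
  have hτ (c : ℂ) : Function.Bijective (τ c) := by
    refine LinearMap.bijective_of_ne_zero fun h => ?_
    obtain ⟨w, hw⟩ := hφ c
    exact hw (sub_eq_zero.1 (LinearMap.congr_fun h w))
  have hψ (c : ℂ) (w : M) :
      Polynomial.aeval ψ (Polynomial.X - Polynomial.C c) w = τ c w := by
    simp [τ, ψ, Module.algebraMap_end_apply]
  -- Over `ℂ` a nonzero `p` splits, so `p(φ)` is a nonzero scalar times a product of injective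
  -- operators `φ - c`.
  have hinj (p : Polynomial ℂ) (hp : p ≠ 0) (w : M) (hw : Polynomial.aeval ψ p w = 0) : w = 0 := by
    induction hd : p.natDegree generalizing p w with
    | zero =>
      obtain ⟨c, rfl⟩ := Polynomial.natDegree_eq_zero.1 hd
      rw [Polynomial.aeval_C, Module.algebraMap_end_apply] at hw
      exact (smul_eq_zero.1 hw).resolve_left fun h => hp (by rw [h, Polynomial.C_0])
    | succ n ih =>
      obtain ⟨c, hc⟩ := IsAlgClosed.exists_root p fun h => by
        rw [Polynomial.natDegree_eq_of_degree_eq_some h] at hd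
        exact absurd hd (Nat.succ_ne_zero n).symm
      obtain ⟨q, rfl⟩ := Polynomial.dvd_iff_isRoot.2 hc
      have hq : q ≠ 0 := right_ne_zero_of_mul hp
      rw [Polynomial.natDegree_mul (left_ne_zero_of_mul hp) hq, Polynomial.natDegree_X_sub_C] at hd
      rw [map_mul, Module.End.mul_apply, hψ] at hw
      exact ih q hq w ((map_eq_zero_iff _ (hτ c).1).1 hw) (by omega)
  choose ρ hρ using fun c => (hτ c).2 v
  have hli : LinearIndependent ℂ ρ := by
    classical
    refine linearIndependent_iff'.2 fun t k hk i hi => ?_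
    -- Clearing denominators in `∑ k i (φ - i)⁻¹ v = 0` gives `p(φ) v = 0`, hence `p = 0`;
    -- evaluating at `i` leaves `k i` times a nonzero product.
    let p : Polynomial ℂ := ∑ i ∈ t, Polynomial.C (k i) *
      ∏ j ∈ t.erase i, (Polynomial.X - Polynomial.C j)
    have hp : p = 0 := by
      by_contra hp
      refine hv (hinj p hp v ?_)
      have key : ∀ i ∈ t, Polynomial.aeval ψ (Polynomial.C (k i) *
          ∏ j ∈ t.erase i, (Polynomial.X - Polynomial.C j)) v
          = Polynomial.aeval ψ (∏ j ∈ t, (Polynomial.X - Polynomial.C j)) (k i • ρ i) := by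
        intro i hi
        rw [← Finset.prod_erase_mul _ _ hi, map_mul, map_mul, Module.End.mul_apply,
          Module.End.mul_apply, hψ, Polynomial.aeval_C, Module.algebraMap_end_apply,
          LinearMap.map_smul_of_tower, hρ, map_smul]
      simp only [p, map_sum, LinearMap.sum_apply]
      rw [Finset.sum_congr rfl key, ← map_sum, hk, map_zero]
    have hev := congr_arg (Polynomial.eval i) hp
    rw [Polynomial.eval_finsetSum, Finset.sum_eq_single i] at hev
    · rw [Polynomial.eval_mul, Polynomial.eval_C, Polynomial.eval_prod, Polynomial.eval_zero] at hev
      refine (mul_eq_zero.1 hev).resolve_right (Finset.prod_ne_zero_iff.2 fun j hj => ?_)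
      simpa [sub_ne_zero] using (Finset.ne_of_mem_erase hj).symm
    · intro j _ hj
      rw [Polynomial.eval_mul, Polynomial.eval_prod,
        Finset.prod_eq_zero (Finset.mem_erase.2 ⟨hj.symm, hi⟩) (by simp), mul_zero]
    · exact fun h => (h hi).elim
  have h₁ := hli.cardinal_lift_le_rank
  have h₂ : Module.rank ℂ M ≤ Cardinal.aleph0 := by
    rw [← rank_top, ← hspan]
    exact (rank_span_le s).trans hs.le_aleph0
  have h₃ := h₁.trans (Cardinal.lift_le.2 h₂)
  rw [Cardinal.lift_aleph0, Cardinal.lift_le_aleph0, Cardinal.mk_complex] at h₃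
  exact absurd h₃ (not_le.2 Cardinal.aleph0_lt_continuum)

/-- All `R`-endomorphisms are scalars, so any `ℂ`-linear `f` commutes with them and Jacobson density
applies to it. -/
theorem exists_smul_eq_of_countable_span {R : Type*} {M : Type*} [Ring R] [AddCommGroup M]
    [Algebra ℂ R] [Module ℂ M] [Module R M] [IsScalarTower ℂ R M] [IsSimpleModule R M]
    {s : Set M} (hs : s.Countable) (hspan : Submodule.span ℂ s = ⊤) (f : Module.End ℂ M)
    (t : Finset M) : ∃ r : R, ∀ w ∈ t, r • w = f w := by
  let F : Module.End (Module.End R M) M :=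
    { toFun := f
      map_add' := map_add f
      map_smul' := fun φ w => by
        obtain ⟨c, hc⟩ := linearMap_eq_smul_of_countable_span hs hspan φ
        rw [RingHom.id_apply, Module.End.smul_def, Module.End.smul_def, hc, hc, map_smul] }
  obtain ⟨r, hr⟩ := jacobson_density (R := R) F t
  exact ⟨r, fun w hw => (hr w hw).symm⟩

variable {g : Type u} [LieRing g] [LieAlgebra ℂ g] {V : Type v} [AddCommGroup V] [Module ℂ V]
  [LieRingModule g V] [LieModule ℂ g V]

variable (g V) in
/-- The associative algebra of operators on `V` generated by the action of `g`. -/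
def actionAlgebra : Subalgebra ℂ (Module.End ℂ V) :=
  Algebra.adjoin ℂ (Set.range (LieModule.toEnd ℂ g V))

theorem toEnd_mem_actionAlgebra (x : g) : LieModule.toEnd ℂ g V x ∈ actionAlgebra g V :=
  Algebra.subset_adjoin ⟨x, rfl⟩

theorem isSimpleModule_actionAlgebra [LieModule.IsIrreducible ℂ g V] :
    IsSimpleModule (actionAlgebra g V) V := by
  have : Nontrivial V := LieModule.nontrivial_of_isIrreducible ℂ g V
  refine (isSimpleModule_iff _ _).2 (IsSimpleOrder.of_forall_eq_top fun N hN => ?_)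
  let N' : LieSubmodule ℂ g V :=
    { N.restrictScalars ℂ with
      lie_mem := fun {x w} hw =>
        N.smul_mem (⟨_, toEnd_mem_actionAlgebra x⟩ : actionAlgebra g V) hw }
  have h : N' = ⊤ := by
    refine (IsSimpleOrder.eq_bot_or_eq_top N').resolve_left fun h => hN ?_
    rw [eq_bot_iff]
    intro w hw
    have : w ∈ N' := hw
    rwa [h, LieSubmodule.mem_bot] at this
  rw [eq_top_iff]
  intro w _
  have : w ∈ N' := h ▸ LieSubmodule.mem_top w
  exact this

/-- Words in a finite basis of `g`, applied to `v`, already span a `g`-stable subspace, and there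
are countably many words. -/
theorem exists_countable_span_eq_top [FiniteDimensional ℂ g] {v : V}
    (hv : LieSubmodule.lieSpan ℂ g {v} = ⊤) :
    ∃ s : Set V, s.Countable ∧ Submodule.span ℂ s = ⊤ := by
  let e := Module.finBasis ℂ g
  let word (l : List (Fin (Module.finrank ℂ g))) : V := l.foldr (fun i w => ⁅e i, w⁆) v
  refine ⟨Set.range word, Set.countable_range word, ?_⟩
  let N : LieSubmodule ℂ g V :=
    { Submodule.span ℂ (Set.range word) with
      lie_mem := fun {x w} hw => by
        change w ∈ Submodule.span ℂ (Set.range word) at hw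
        change ⁅x, w⁆ ∈ Submodule.span ℂ (Set.range word)
        rw [← e.sum_repr x, sum_lie]
        refine Submodule.sum_mem _ fun i _ => ?_
        rw [smul_lie]
        refine Submodule.smul_mem _ _ ?_
        induction hw using Submodule.span_induction with
        | mem w hw =>
          obtain ⟨l, rfl⟩ := hw
          exact Submodule.subset_span ⟨i :: l, rfl⟩
        | zero => rw [lie_zero]; exact Submodule.zero_mem _
        | add y z _ _ hy hz => rw [lie_add]; exact Submodule.add_mem _ hy hz
        | smul c y _ hy => rw [lie_smul]; exact Submodule.smul_mem _ _ hy }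
  have hN : N = ⊤ := by
    rw [eq_top_iff, ← hv, LieSubmodule.lieSpan_le, Set.singleton_subset_iff]
    exact Submodule.subset_span ⟨[], rfl⟩
  rw [eq_top_iff]
  intro w _
  have : w ∈ N := hN ▸ LieSubmodule.mem_top w
  exact this

theorem exists_mem_actionAlgebra_apply_eq [FiniteDimensional ℂ g] [LieModule.IsIrreducible ℂ g V]
    (f : Module.End ℂ V) (t : Finset V) : ∃ X ∈ actionAlgebra g V, ∀ w ∈ t, X w = f w := by
  have := isSimpleModule_actionAlgebra (g := g) (V := V)
  have : Nontrivial V := LieModule.nontrivial_of_isIrreducible ℂ g V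
  obtain ⟨v, hv⟩ := exists_ne (0 : V)
  have hspan : LieSubmodule.lieSpan ℂ g {v} = ⊤ := by
    refine (IsSimpleOrder.eq_bot_or_eq_top _).resolve_left fun h => hv ?_
    have : v ∈ LieSubmodule.lieSpan ℂ g {v} := LieSubmodule.subset_lieSpan rfl
    rwa [h, LieSubmodule.mem_bot] at this
  obtain ⟨s, hs, hs'⟩ := exists_countable_span_eq_top hspan
  obtain ⟨X, hX⟩ := exists_smul_eq_of_countable_span (R := actionAlgebra g V) hs hs' f t
  exact ⟨X, X.2, hX⟩

end Density

/-! ### Irreducibility of the outer tensor product -/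

section OuterTensor

open AffineKM Module

variable {g : Type u} [LieRing g] [LieAlgebra ℂ g] {m : ℕ} (V : Fin m → Type v)
  [∀ i, AddCommGroup (V i)] [∀ i, Module ℂ (V i)]

theorem siteOp_one (i : Fin m) : siteOp V i 1 = 1 := by
  apply PiTensorProduct.ext
  ext v
  simp [siteOp_tprod]

theorem list_prod_siteOp_tprod (f : ∀ i, Module.End ℂ (V i)) (l : List (Fin m)) (hl : l.Nodup)
    (v : ∀ i, V i) :
    (l.map fun i => siteOp V i (f i)).prod (PiTensorProduct.tprod ℂ v)
      = PiTensorProduct.tprod ℂ fun i => if i ∈ l then f i (v i) else v i := by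
  induction l with
  | nil => simp
  | cons i l ih =>
    rw [List.nodup_cons] at hl
    rw [List.map_cons, List.prod_cons, Module.End.mul_apply, ih hl.2, siteOp_tprod]
    congr 1
    ext j
    rcases eq_or_ne j i with rfl | h
    · simp [hl.1]
    · simp [h]

theorem tprod_ne_zero {v : ∀ i, V i} (hv : ∀ i, v i ≠ 0) : PiTensorProduct.tprod ℂ v ≠ 0 := by
  intro h
  let e := fun i => Module.Basis.ofVectorSpace ℂ (V i)
  have hp : ∀ i, ∃ p, (e i).repr (v i) p ≠ 0 := fun i => by
    by_contra! h'
    exact hv i ((e i).repr.map_eq_zero_iff.1 (Finsupp.ext h'))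
  choose p hp using hp
  have := Basis.piTensorProduct_repr_tprod_apply e v p
  rw [h, map_zero, Finsupp.zero_apply] at this
  exact Finset.prod_ne_zero_iff.2 (fun i _ => hp i) this.symm

variable [∀ i, LieRingModule g (V i)] [∀ i, LieModule ℂ g (V i)]

variable (g) in
/-- A subspace of `V 1 ⊗ ... ⊗ V m` that is stable under the action of `g` on each factor. -/
def IsSiteStable (N : Submodule ℂ (⨂[ℂ] j, V j)) : Prop :=
  ∀ (i : Fin m) (x : g), ∀ w ∈ N, siteOp V i (LieModule.toEnd ℂ g (V i) x) w ∈ N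

variable {V}

theorem IsSiteStable.siteOp_mem {N : Submodule ℂ (⨂[ℂ] j, V j)} (hN : IsSiteStable g V N)
    (i : Fin m) {X : Module.End ℂ (V i)} (hX : X ∈ actionAlgebra g (V i)) {w : ⨂[ℂ] j, V j}
    (hw : w ∈ N) : siteOp V i X w ∈ N := by
  induction hX using Algebra.adjoin_induction generalizing w with
  | mem X hX =>
    obtain ⟨x, rfl⟩ := hX
    exact hN i x w hw
  | algebraMap c =>
    rw [Algebra.algebraMap_eq_smul_one, map_smul, siteOp_one]
    exact N.smul_mem c hw
  | add X Y _ _ hX hY =>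
    rw [map_add]
    exact N.add_mem (hX hw) (hY hw)
  | mul X Y _ _ hX hY =>
    rw [siteOp_mul]
    exact hX (hY hw)

theorem IsSiteStable.list_prod_mem {N : Submodule ℂ (⨂[ℂ] j, V j)} (hN : IsSiteStable g V N)
    {X : ∀ i, Module.End ℂ (V i)} (hX : ∀ i, X i ∈ actionAlgebra g (V i)) (l : List (Fin m))
    {w : ⨂[ℂ] j, V j} (hw : w ∈ N) : (l.map fun i => siteOp V i (X i)).prod w ∈ N := by
  induction l with
  | nil => exact hw
  | cons i l ih =>
    rw [List.map_cons, List.prod_cons]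
    exact hN.siteOp_mem i (hX i) ih

/-- Density on each factor supplies operators which isolate one basis tensor of a nonzero `z` and
move it to an arbitrary pure tensor. -/
theorem IsSiteStable.eq_top [FiniteDimensional ℂ g] [∀ i, LieModule.IsIrreducible ℂ g (V i)]
    {N : Submodule ℂ (⨂[ℂ] j, V j)} (hN : IsSiteStable g V N) (hne : N ≠ ⊥) : N = ⊤ := by
  classical
  obtain ⟨z, hz, hz0⟩ := N.exists_mem_ne_zero_of_ne_bot hne
  let e := fun i => Module.Basis.ofVectorSpace ℂ (V i)
  let E := Basis.piTensorProduct e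
  obtain ⟨p, hp⟩ : ∃ p, E.repr z p ≠ 0 := by
    by_contra! h
    exact hz0 (E.repr.map_eq_zero_iff.1 (Finsupp.ext h))
  have key (y : ∀ i, V i) : PiTensorProduct.tprod ℂ y ∈ N := by
    -- `X i` sends the basis vector `e i (p i)` to `y i` and kills the other basis vectors of the
    -- `i`-th factor that occur in `z`; only finitely many occur, which is what density can handle.
    choose X hX hXe using fun i => exists_mem_actionAlgebra_apply_eq (g := g)
      ((e i).constr ℂ fun k => if k = p i then y i else 0)
      ((E.repr z).support.image fun q => e i (q i))
    have h := hN.list_prod_mem hX (List.finRange m) hz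
    have h' : ((List.finRange m).map fun i => siteOp V i (X i)).prod z
        = E.repr z p • PiTensorProduct.tprod ℂ y := by
      conv_lhs => rw [← E.linearCombination_repr z, Finsupp.linearCombination_apply, Finsupp.sum]
      rw [map_sum, Finset.sum_eq_single p]
      · rw [map_smul, Basis.piTensorProduct_apply,
          list_prod_siteOp_tprod V X _ (List.nodup_finRange m)]
        congr 2
        ext i
        rw [if_pos (List.mem_finRange i), hXe i _ (Finset.mem_image_of_mem _
          (Finsupp.mem_support_iff.2 hp)), Module.Basis.constr_basis, if_pos rfl]
      · intro q hq hqp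
        obtain ⟨i, hi⟩ := Function.ne_iff.1 hqp
        rw [map_smul, Basis.piTensorProduct_apply,
          list_prod_siteOp_tprod V X _ (List.nodup_finRange m)]
        rw [MultilinearMap.map_coord_zero _ i, smul_zero]
        rw [if_pos (List.mem_finRange i), hXe i _ (Finset.mem_image_of_mem _ hq),
          Module.Basis.constr_basis, if_neg hi]
      · intro h
        rw [Finsupp.notMem_support_iff.1 h, zero_smul, map_zero]
    rw [h'] at h
    exact (N.smul_mem_iff hp).1 h
  rw [eq_top_iff, ← PiTensorProduct.span_tprod_eq_top, Submodule.span_le]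
  rintro _ ⟨y, rfl⟩
  exact key y

/-- The vectors killed by `g` at every site form a site-stable subspace, so it is zero or
everything; a pure tensor with `v` in position `i` rules out the latter. -/
theorem exists_siteOp_ne_zero [FiniteDimensional ℂ g] [∀ i, LieModule.IsIrreducible ℂ g (V i)]
    {i : Fin m} {x : g} {v : V i} (hv : ⁅x, v⁆ ≠ 0) {w : ⨂[ℂ] j, V j} (hw : w ≠ 0) :
    ∃ (j : Fin m) (y : g), siteOp V j (LieModule.toEnd ℂ g (V j) y) w ≠ 0 := by
  by_contra! h
  let N : Submodule ℂ (⨂[ℂ] j, V j) :=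
    ⨅ (j : Fin m) (y : g), LinearMap.ker (siteOp V j (LieModule.toEnd ℂ g (V j) y))
  have hmem {z : ⨂[ℂ] j, V j} :
      z ∈ N ↔ ∀ (j : Fin m) (y : g), siteOp V j (LieModule.toEnd ℂ g (V j) y) z = 0 := by
    simp [N, Submodule.mem_iInf]
  have hN : IsSiteStable g V N := fun j y z hz => by
    rw [hmem.1 hz j y]
    exact N.zero_mem
  have htop : N = ⊤ := hN.eq_top fun hbot => hw ((Submodule.eq_bot_iff N).1 hbot w (hmem.2 h))
  have : ∀ j, Nontrivial (V j) := fun j => LieModule.nontrivial_of_isIrreducible ℂ g (V j)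
  choose u hu using fun j => exists_ne (0 : V j)
  have h0 := hmem.1 (htop ▸ Submodule.mem_top : PiTensorProduct.tprod ℂ (Function.update u i v) ∈ N)
    i x
  rw [siteOp_tprod] at h0
  refine tprod_ne_zero V (fun j => ?_) h0
  rcases eq_or_ne j i with rfl | hj
  · simpa using hv
  · simpa [hj] using hu j

end OuterTensor

/-! ### The shift operator on polynomials and separation of sites -/

section Shift

open Polynomial

/-- The shift `p(X) ↦ p(X - 1)`. -/
def polyShift : Module.End ℂ ℂ[X] := taylor (-1)

theorem polyShift_pow_apply (n : ℕ) (p : ℂ[X]) :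
    (polyShift ^ n) p = taylor (-(n : ℂ)) p := by
  induction n with
  | zero => simp
  | succ n ih =>
    rw [pow_succ', Module.End.mul_apply, ih, polyShift, taylor_taylor]
    congr 1
    push_cast
    ring_nf

theorem natDegree_polyShift_sub_one_le {n : ℕ} {p : ℂ[X]} (hp : p.natDegree ≤ n + 1) :
    ((polyShift - 1) p).natDegree ≤ n := by
  rw [natDegree_le_iff_coeff_eq_zero]
  intro k hk
  rw [LinearMap.sub_apply, Module.End.one_apply, coeff_sub, polyShift, sub_eq_zero]
  rcases hp.lt_or_eq with hp' | hp'
  · rw [coeff_eq_zero_of_natDegree_lt (by rw [natDegree_taylor]; omega),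
      coeff_eq_zero_of_natDegree_lt (by omega)]
  · rcases (Nat.succ_le_of_lt hk).lt_or_eq with hk' | hk'
    · rw [coeff_eq_zero_of_natDegree_lt (by rw [natDegree_taylor]; omega),
        coeff_eq_zero_of_natDegree_lt (by omega)]
    · rw [← hk', Nat.succ_eq_add_one, ← hp', coeff_taylor_natDegree, coeff_natDegree]

theorem coeff_polyShift_sub_one {n : ℕ} {p : ℂ[X]} (hp : p.natDegree ≤ n + 1) :
    ((polyShift - 1) p).coeff n = -((n : ℂ) + 1) * p.coeff (n + 1) := by
  -- The `n`-th Taylor coefficient at `-1` is the value there of the `n`-th Hasse derivative, which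
  -- here has degree at most one, so only two terms survive.
  have h : (hasseDeriv n p).natDegree < 2 := by
    have := natDegree_hasseDeriv_le p n
    omega
  rw [LinearMap.sub_apply, Module.End.one_apply, coeff_sub, polyShift, taylor_coeff,
    eval_eq_sum_range' h, Finset.sum_range_succ, Finset.sum_range_one, hasseDeriv_coeff,
    hasseDeriv_coeff]
  simp [add_comm 1 n]
  ring

/-- Each application of `S - 1` lowers the degree by one and multiplies the top coefficient by minus
the old degree. -/
theorem polyShift_sub_one_pow_apply (n : ℕ) {p : ℂ[X]} (hp : p.natDegree ≤ n) :
    ((polyShift - 1) ^ n) p = C ((-1) ^ n * (n.factorial : ℂ) * p.coeff n) := by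
  induction n generalizing p with
  | zero => simpa using eq_C_of_natDegree_le_zero hp
  | succ n ih =>
    rw [pow_succ, Module.End.mul_apply, ih (natDegree_polyShift_sub_one_le hp),
      coeff_polyShift_sub_one hp, Nat.factorial_succ]
    congr 1
    push_cast
    ring

theorem aeval_smul_polyShift_C (a : ℂ) (f : ℂ[X]) (c : ℂ) :
    aeval (a • polyShift) f (C c) = C (f.eval a * c) := by
  have hS : (a • polyShift) (C c) = a • C c := by
    rw [LinearMap.smul_apply, polyShift, taylor_C]
  induction f using Polynomial.induction_on' with
  | add p q hp hq => rw [map_add, LinearMap.add_apply, hp, hq, eval_add, add_mul, C_add]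
  | monomial n r =>
    rw [aeval_monomial, Module.End.mul_apply, Module.algebraMap_end_apply, eval_monomial]
    have : ((a • polyShift) ^ n) (C c) = a ^ n • C c := by
      induction n with
      | zero => simp
      | succ n ih => rw [pow_succ, Module.End.mul_apply, hS, map_smul, ih, smul_smul, pow_succ']
    rw [this, smul_smul, smul_C, smul_eq_mul]

theorem aeval_smul_polyShift_X_sub_C_pow (a : ℂ) (n : ℕ) :
    aeval (a • polyShift) ((X - C a) ^ n) = a ^ n • (polyShift - 1) ^ n := by
  have h : a • polyShift - a • (1 : Module.End ℂ ℂ[X]) = a • (polyShift - 1) :=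
    (smul_sub a polyShift 1).symm
  rw [map_pow, map_sub, aeval_X, aeval_C, Algebra.algebraMap_eq_smul_one, h, _root_.smul_pow]

/-- In degree at most `K`, `(X - a l) ^ (K + 1)` evaluated at `a l S` vanishes, while its `K`-th
power analogue leaves only a constant proportional to the degree `K` coefficient. Using exponent `K
+ 1` at the other sites and `K` at site `i` separates the two cases. -/
theorem exists_aeval_smul_polyShift {m : ℕ} (a : Fin m → ℂˣ) (ha : Function.Injective a) (K : ℕ)
    (i : Fin m) : ∃ f : ℂ[X], ∀ l, ∀ p : ℂ[X], p.natDegree ≤ K →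
      aeval ((a l : ℂ) • polyShift) f p = if l = i then C (p.coeff K) else 0 := by
  classical
  let q : ℂ[X] := ∏ j ∈ Finset.univ.erase i, (X - C (a j : ℂ)) ^ (K + 1)
  -- The total scalar at site `i`: `q` acts on the constant left by `(X - a i) ^ K` as `q (a i)`. It
  -- is nonzero because the points are distinct and nonzero.
  let s : ℂ := q.eval (a i : ℂ) * ((a i : ℂ) ^ K * ((-1) ^ K * (K.factorial : ℂ)))
  have hs : s ≠ 0 := by
    refine mul_ne_zero ?_ (mul_ne_zero (pow_ne_zero _ (a i).ne_zero)
      (mul_ne_zero (pow_ne_zero _ (by norm_num)) (Nat.cast_ne_zero.2 K.factorial_ne_zero)))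
    rw [eval_prod]
    refine Finset.prod_ne_zero_iff.2 fun j hj => ?_
    rw [eval_pow, eval_sub, eval_X, eval_C]
    refine pow_ne_zero _ (sub_ne_zero.2 fun h => Finset.ne_of_mem_erase hj ?_)
    exact (ha (Units.ext h)).symm
  refine ⟨s⁻¹ • (q * (X - C (a i : ℂ)) ^ K), fun l p hp => ?_⟩
  rw [map_smul, LinearMap.smul_apply]
  split_ifs with hl
  · subst hl
    rw [map_mul, Module.End.mul_apply, aeval_smul_polyShift_X_sub_C_pow, LinearMap.smul_apply,
      polyShift_sub_one_pow_apply K hp, smul_C, aeval_smul_polyShift_C, smul_C]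
    congr 1
    rw [smul_eq_mul, smul_eq_mul, inv_mul_eq_iff_eq_mul₀ hs]
    ring
  · have hq : q = (∏ j ∈ (Finset.univ.erase i).erase l, (X - C (a j : ℂ)) ^ (K + 1)) *
        (X - C (a l : ℂ)) ^ (K + 1) :=
      (Finset.prod_erase_mul _ _ (Finset.mem_erase.2 ⟨hl, Finset.mem_univ l⟩)).symm
    rw [hq, mul_right_comm, map_mul, Module.End.mul_apply, aeval_smul_polyShift_X_sub_C_pow,
      LinearMap.smul_apply, polyShift_sub_one_pow_apply (K + 1) (by omega),
      coeff_eq_zero_of_natDegree_lt (by omega)]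
    simp

end Shift

/-! ### Induced modules: generation over the enveloping algebra -/

namespace InducedModule

attribute [local instance 100] LieRing.ofAssociativeRing

variable {R : Type*} {L : Type*} {M : Type*} [CommRing R] [LieRing L] [LieAlgebra R L]
  (S : LieSubalgebra R L) [AddCommGroup M] [Module R M] [LieRingModule S M]

/-- The bilinear map `(u, w) ↦ u ⊗ w` to the induced module. -/
def mkBilin : UniversalEnvelopingAlgebra R L →ₗ[R] M →ₗ[R] InducedModule M S :=
  (TensorProduct.mk R (UniversalEnvelopingAlgebra R L) M).compr₂
    ((inducedRelations M S).mkQ.restrictScalars R)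

theorem smul_mk (u u' : UniversalEnvelopingAlgebra R L) (w : M) :
    u • mk S u' w = mk S (u * u') w := rfl

theorem mk_induction {p : InducedModule M S → Prop} (z : InducedModule M S) (h0 : p 0)
    (hmk : ∀ u w, p (mk S u w)) (hadd : ∀ y z, p y → p z → p (y + z)) : p z := by
  obtain ⟨t, rfl⟩ := (inducedRelations M S).mkQ_surjective z
  refine TensorProduct.induction_on (motive := fun t => p ((inducedRelations M S).mkQ t)) t ?_ hmk
    fun x y hx hy => ?_
  · rw [map_zero]
    exact h0
  · rw [map_add]
    exact hadd _ _ hx hy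

/-- The elements of `U(L)` preserving `Q` form a subalgebra containing `L`. By the universal
property, the identity of `U(L)` factors through it. -/
theorem smul_mem_of_lie_mem {Q : Submodule R (InducedModule M S)}
    (hQ : ∀ (x : L), ∀ z ∈ Q, ⁅x, z⁆ ∈ Q) (u : UniversalEnvelopingAlgebra R L)
    {z : InducedModule M S} (hz : z ∈ Q) : u • z ∈ Q := by
  let B : Subalgebra R (UniversalEnvelopingAlgebra R L) :=
    { carrier := {u | ∀ z ∈ Q, u • z ∈ Q}
      mul_mem' := fun {u u'} hu hu' z hz => by
        rw [mul_smul]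
        exact hu _ (hu' _ hz)
      add_mem' := fun {u u'} hu hu' z hz => by
        rw [add_smul]
        exact Q.add_mem (hu _ hz) (hu' _ hz)
      algebraMap_mem' := fun r z hz => by
        rw [algebraMap_smul]
        exact Q.smul_mem r hz }
  let f : L →ₗ⁅R⁆ B :=
    { toFun := fun x => ⟨UniversalEnvelopingAlgebra.ι R x, hQ x⟩
      map_add' := fun x y => Subtype.ext (map_add _ x y)
      map_smul' := fun r x => Subtype.ext (map_smul _ r x)
      map_lie' := fun {x y} => Subtype.ext (LieHom.map_lie _ x y) }
  have h : B.val.comp (UniversalEnvelopingAlgebra.lift R f) = AlgHom.id R _ := by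
    apply UniversalEnvelopingAlgebra.hom_ext
    ext x
    change B.val (UniversalEnvelopingAlgebra.lift R f (UniversalEnvelopingAlgebra.ι R x))
      = UniversalEnvelopingAlgebra.ι R x
    rw [UniversalEnvelopingAlgebra.lift_ι_apply]
    rfl
  have hu := (UniversalEnvelopingAlgebra.lift R f u).2 z hz
  have : ((UniversalEnvelopingAlgebra.lift R f u : B) : UniversalEnvelopingAlgebra R L) = u :=
    AlgHom.congr_fun h u
  rwa [this] at hu

end InducedModule

/-! ### Polynomials in `d` with coefficients in the evaluation module -/

namespace AffineKM

open Polynomial AffineAlgebra UniversalEnvelopingAlgebra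

attribute [local instance 100] LieRing.ofAssociativeRing

variable {g : Type u} [LieRing g] [LieAlgebra ℂ g]

theorem ofLoop_mem_hat (z : Loop g) : ofLoop z ∈ hat g :=
  show degreeCoeff (ofLoop z) = 0 from rfl

theorem sub_smul_d_mem_hat (y : AffineAlgebra g) : y - degreeCoeff y • d g ∈ hat g := by
  change degreeCoeff (y - degreeCoeff y • d g) = 0
  rw [map_sub, map_smul, show degreeCoeff (d g) = 1 from rfl, smul_eq_mul, mul_one, sub_self]

variable (g) in
/-- The image of `d` in the enveloping algebra. -/
def envD : UniversalEnvelopingAlgebra ℂ (AffineAlgebra g) := ι ℂ (d g)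

theorem ι_lie_eq (x y : AffineAlgebra g) : ι ℂ x * ι ℂ y = ι ℂ y * ι ℂ x + ι ℂ ⁅x, y⁆ := by
  rw [LieHom.map_lie, Ring.lie_def]
  abel

/-- From `[d, x ⊗ t ^ n] = n x ⊗ t ^ n`, passing `x ⊗ t ^ n` to the right of `d` replaces `d` by `d
- n`. -/
theorem ι_loopMono_mul_aeval (x : g) (n : ℕ) (p : ℂ[X]) :
    ι ℂ (ofLoop (loopMono x n)) * aeval (envD g) p
      = aeval (envD g) ((polyShift ^ n) p) * ι ℂ (ofLoop (loopMono x n)) := by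
  rw [polyShift_pow_apply]
  have hd : ι ℂ (ofLoop (loopMono x n)) * envD g
      = (envD g + algebraMap ℂ _ (-(n : ℂ))) * ι ℂ (ofLoop (loopMono x n)) := by
    have := ι_lie_eq (d g) (ofLoop (loopMono x n))
    rw [lie_d_mono, map_smul, Int.cast_natCast] at this
    rw [envD, add_mul, this, map_neg, neg_mul, ← Algebra.smul_def]
    abel
  induction p using Polynomial.induction_on' with
  | add p q hp hq => rw [map_add, mul_add, hp, hq, map_add, map_add, add_mul]
  | monomial k r =>
    rw [taylor_monomial, aeval_monomial, map_mul, aeval_C, map_pow, map_add, aeval_X, aeval_C,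
      ← mul_assoc, ← Algebra.commutes, mul_assoc, mul_assoc]
    congr 1
    induction k with
    | zero => simp
    | succ k ih => rw [pow_succ, ← mul_assoc, ih, mul_assoc, hd, ← mul_assoc, ← pow_succ]

variable {m : ℕ} (a : Fin m → ℂˣ) (V : Fin m → Type v)
  [∀ i, AddCommGroup (V i)] [∀ i, Module ℂ (V i)]
  [∀ i, LieRingModule g (V i)] [∀ i, LieModule ℂ g (V i)]

/-- The action of `x` on the `i`-th factor of the evaluation module. -/
def siteAction (i : Fin m) (x : g) : Module.End ℂ (EvalModule a V) :=
  siteOp V i (LieModule.toEnd ℂ g (V i) x)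

theorem loopMono_lie_eval (x : g) (n : ℤ) (s : hat g)
    (hs : (s : AffineAlgebra g) = ofLoop (loopMono x n)) (w : EvalModule a V) :
    ⁅s, w⁆ = ∑ i, ((a i : ℂ) ^ n) • siteAction a V i x w := by
  have key : evalOp V a s
      = ∑ i, ((a i : ℂ) ^ n) • siteOp V i (LieModule.toEnd ℂ g (V i) x) := by
    rw [evalOp_apply, hs]
    refine Finset.sum_congr rfl fun i _ => ?_
    rw [← map_smul, ← map_smul, ← loopEval_mono]
    rfl
  exact (LinearMap.congr_fun key w).trans (LinearMap.sum_apply _ _ _)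

/-- The affine module `Ind E(lam, a)`. -/
abbrev Ind (g : Type u) [LieRing g] [LieAlgebra ℂ g] {m : ℕ} (a : Fin m → ℂˣ) (V : Fin m → Type v)
    [∀ i, AddCommGroup (V i)] [∀ i, Module ℂ (V i)]
    [∀ i, LieRingModule g (V i)] [∀ i, LieModule ℂ g (V i)] :=
  InducedModule (EvalModule a V) (hat g)

/-- The element `p(d) ⊗ w`, as a bilinear map. -/
def polyMk : ℂ[X] →ₗ[ℂ] EvalModule a V →ₗ[ℂ] Ind g a V :=
  InducedModule.mkBilin (hat g) ∘ₗ (aeval (envD g)).toLinearMap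

theorem polyMk_apply (p : ℂ[X]) (w : EvalModule a V) :
    polyMk (g := g) a V p w = InducedModule.mk (hat g) (aeval (envD g) p) w := rfl

theorem loopMono_lie_polyMk (x : g) (n : ℕ) (p : ℂ[X]) (w : EvalModule a V) :
    ⁅ofLoop (loopMono x n), polyMk (g := g) a V p w⁆
      = ∑ i, polyMk a V (((a i : ℂ) • polyShift) ^ n • p) (siteAction a V i x w) := by
  have h := InducedModule.mk_mul (hat g) (aeval (envD g) ((polyShift ^ n) p))
    ⟨_, ofLoop_mem_hat (loopMono x n)⟩ w
  rw [polyMk_apply, InducedModule.lie_mk, ι_loopMono_mul_aeval]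
  refine h.trans ?_
  rw [loopMono_lie_eval a V x n _ rfl, ← polyMk_apply, map_sum]
  refine Finset.sum_congr rfl fun i _ => ?_
  rw [map_smul, _root_.smul_pow, Module.End.smul_def, LinearMap.smul_apply, map_smul, LinearMap.smul_apply,
    zpow_natCast]

/-- The element `x ⊗ f` of the loop algebra, for a polynomial `f`. -/
def polyLoop (x : g) (f : ℂ[X]) : AffineAlgebra g := f.sum fun n c => c • ofLoop (loopMono x n)

theorem polyLoop_lie_polyMk (x : g) (f : ℂ[X]) (p : ℂ[X]) (w : EvalModule a V) :
    ⁅polyLoop x f, polyMk (g := g) a V p w⁆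
      = ∑ i, polyMk a V (aeval ((a i : ℂ) • polyShift) f p) (siteAction a V i x w) := by
  simp only [polyLoop, aeval_eq_sum_range, Polynomial.sum_over_range' f (f :=
    fun n (c : ℂ) => c • ofLoop (loopMono x n)) (fun n => zero_smul _ _) _ (Nat.lt_succ_self _),
    sum_lie, smul_lie, loopMono_lie_polyMk, LinearMap.sum_apply, LinearMap.smul_apply, map_sum,
    map_smul, Finset.smul_sum]
  rw [Finset.sum_comm]
  rfl

theorem d_lie_polyMk (p : ℂ[X]) (w : EvalModule a V) :
    ⁅d g, polyMk (g := g) a V p w⁆ = polyMk a V (X * p) w := by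
  rw [polyMk_apply, polyMk_apply, InducedModule.lie_mk, map_mul, aeval_X]
  rfl

/-- The map from polynomials in `d` with coefficients in `E` onto the induced module. -/
def polyMap : (ℕ →₀ EvalModule a V) →ₗ[ℂ] Ind g a V :=
  Finsupp.lsum ℂ fun k => polyMk a V (X ^ k)

theorem polyMap_apply (c : ℕ →₀ EvalModule a V) :
    polyMap (g := g) a V c = ∑ k ∈ c.support, polyMk a V (X ^ k) (c k) := rfl

theorem polyMap_single (k : ℕ) (w : EvalModule a V) :
    polyMap (g := g) a V (Finsupp.single k w) = polyMk a V (X ^ k) w :=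
  Finsupp.lsum_single ..

theorem d_lie_mem_range {z : Ind g a V} (hz : z ∈ LinearMap.range (polyMap (g := g) a V)) :
    ⁅d g, z⁆ ∈ LinearMap.range (polyMap (g := g) a V) := by
  obtain ⟨c, rfl⟩ := hz
  rw [polyMap_apply, lie_sum]
  refine Submodule.sum_mem _ fun k _ => ⟨Finsupp.single (k + 1) (c k), ?_⟩
  rw [d_lie_polyMk, polyMap_single, pow_succ']

theorem hat_lie_polyMk_mem_range (k : ℕ) (s : AffineAlgebra g) (hs : s ∈ hat g)
    (w : EvalModule a V) :
    ⁅s, polyMk (g := g) a V (X ^ k) w⁆ ∈ LinearMap.range (polyMap (g := g) a V) := by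
  induction k generalizing s with
  | zero =>
    refine ⟨Finsupp.single 0 ⁅(⟨s, hs⟩ : hat g), w⁆, ?_⟩
    rw [polyMap_single, polyMk_apply, polyMk_apply, InducedModule.lie_mk, pow_zero,
      map_one, mul_one, ← InducedModule.mk_mul, one_mul]
  | succ k ih =>
    rw [pow_succ', ← d_lie_polyMk, leibniz_lie]
    -- The bracket of `s` with `d` is again in `hat g`, which is why the induction runs over all `s`
    -- at once.
    refine Submodule.add_mem _ (ih _ ?_) (d_lie_mem_range a V (ih s hs))
    exact degreeCoeff_lie s (d g)

/-- The spanning half of PBW: the range contains `1 ⊗ E` and is stable under both `d` and `hat g`.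
-/
theorem range_polyMap : LinearMap.range (polyMap (g := g) a V) = ⊤ := by
  have hlie (y : AffineAlgebra g) (z : Ind g a V)
      (hz : z ∈ LinearMap.range (polyMap (g := g) a V)) :
      ⁅y, z⁆ ∈ LinearMap.range (polyMap (g := g) a V) := by
    have hy : y = (y - degreeCoeff y • d g) + degreeCoeff y • d g := by abel
    rw [hy, add_lie, smul_lie]
    refine Submodule.add_mem _ ?_ (Submodule.smul_mem _ _ (d_lie_mem_range a V hz))
    obtain ⟨c, rfl⟩ := hz
    rw [polyMap_apply, lie_sum]
    exact Submodule.sum_mem _ fun k _ =>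
      hat_lie_polyMk_mem_range a V k _ (sub_smul_d_mem_hat y) (c k)
  rw [eq_top_iff]
  intro z _
  induction z using InducedModule.mk_induction with
  | h0 => exact Submodule.zero_mem _
  | hadd y z hy hz => exact Submodule.add_mem _ (hy trivial) (hz trivial)
  | hmk u w =>
    have h : InducedModule.mk (hat g) u w = u • InducedModule.mk (hat g) 1 w := by
      rw [InducedModule.smul_mk, mul_one]
    rw [h]
    refine InducedModule.smul_mem_of_lie_mem (hat g) hlie u ⟨Finsupp.single 0 w, ?_⟩
    rw [polyMap_single, polyMk_apply, pow_zero, map_one]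

/-! ### Submodules of the induced module -/

variable {a V}

/-- Apply `x ⊗ f` with the separating polynomial `f` for degree `K` and site `i`: terms of lower
degree have zero coefficient at `K`, and the other sites are annihilated. -/
theorem polyMk_one_siteAction_mem (ha : Function.Injective a)
    (N : LieSubmodule ℂ (AffineAlgebra g) (Ind g a V)) (K : ℕ) (w : ℕ → EvalModule a V)
    (hw : ∑ k ∈ Finset.range (K + 1), polyMk a V (X ^ k) (w k) ∈ N) (i : Fin m) (x : g) :
    polyMk a V 1 (siteAction a V i x (w K)) ∈ N := by
  obtain ⟨f, hf⟩ := exists_aeval_smul_polyShift a ha K i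
  have h := N.lie_mem (x := polyLoop x f) hw
  rw [lie_sum, Finset.sum_eq_single K] at h
  · rw [polyLoop_lie_polyMk, Finset.sum_eq_single i] at h
    · rwa [hf i _ (natDegree_X_pow_le K), if_pos rfl, coeff_X_pow_self, C_1] at h
    · intro l _ hl
      rw [hf l _ (natDegree_X_pow_le K), if_neg hl, map_zero, LinearMap.zero_apply]
    · exact fun h => (h (Finset.mem_univ i)).elim
  · intro k hk hkK
    have hk' : k ≤ K := Nat.lt_succ_iff.1 (Finset.mem_range.1 hk)
    rw [polyLoop_lie_polyMk]
    refine Finset.sum_eq_zero fun l _ => ?_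
    rw [hf l _ ((natDegree_X_pow_le k).trans hk'), coeff_X_pow, if_neg hkK.symm, C_0, ite_self,
      map_zero, LinearMap.zero_apply]
  · exact fun h => (h (Finset.self_mem_range_succ K)).elim

theorem eq_top_of_ne_bot [FiniteDimensional ℂ g] [∀ i, LieModule.IsIrreducible ℂ g (V i)]
    (ha : Function.Injective a) {i : Fin m} {x : g} {v : V i} (hv : ⁅x, v⁆ ≠ 0)
    (N : LieSubmodule ℂ (AffineAlgebra g) (Ind g a V)) (hN : N ≠ ⊥) : N = ⊤ := by
  let N₀ : Submodule ℂ (⨂[ℂ] j, V j) := N.toSubmodule.comap (polyMk (g := g) a V 1)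
  have hN₀ : IsSiteStable g V N₀ := fun j y w hw => by
    -- With `K = 0` the extraction lemma starts from `1 ⊗ w` itself and yields stability at each
    -- single site.
    refine polyMk_one_siteAction_mem ha N 0 (fun _ => w) ?_ j y
    rw [Finset.sum_range_one, pow_zero]
    exact hw
  have hne : N₀ ≠ ⊥ := by
    obtain ⟨z, hz, hz0⟩ := N.toSubmodule.exists_mem_ne_zero_of_ne_bot
      fun h => hN ((LieSubmodule.toSubmodule_eq_bot N).1 h)
    obtain ⟨c, rfl⟩ := (range_polyMap (g := g) a V ▸ Submodule.mem_top :
      z ∈ LinearMap.range (polyMap (g := g) a V))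
    have hc : c.support.Nonempty := Finsupp.support_nonempty_iff.2 fun h => hz0 (by
      rw [h, map_zero])
    -- The top degree of the chosen element, so that `c K ≠ 0`.
    let K := c.support.max' hc
    have hsum : polyMap (g := g) a V c
        = ∑ k ∈ Finset.range (K + 1), polyMk a V (X ^ k) (c k) := by
      rw [polyMap, Finsupp.lsum_apply]
      refine Finsupp.sum_of_support_subset _ (fun k hk => ?_) _ fun k _ => map_zero _
      exact Finset.mem_range.2 (Nat.lt_succ_of_le (Finset.le_max' _ k hk))
    have hK : c K ≠ 0 := Finsupp.mem_support_iff.1 (Finset.max'_mem _ hc)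
    obtain ⟨j, y, hjy⟩ := exists_siteOp_ne_zero hv hK
    rw [hsum] at hz
    exact (Submodule.ne_bot_iff _).2 ⟨_, polyMk_one_siteAction_mem ha N K c hz j y, hjy⟩
  have htop := hN₀.eq_top hne
  rw [eq_top_iff]
  intro z _
  induction z using InducedModule.mk_induction with
  | h0 => exact N.zero_mem
  | hadd y z hy hz => exact N.add_mem (hy trivial) (hz trivial)
  | hmk u w =>
    have h : InducedModule.mk (hat g) u w = u • polyMk (g := g) a V 1 w := by
      rw [polyMk_apply, map_one, InducedModule.smul_mk, mul_one]
    rw [h]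
    have hw : polyMk (g := g) a V 1 w ∈ N :=
      htop.ge (Submodule.mem_top (R := ℂ) (M := ⨂[ℂ] j, V j) (x := w))
    exact InducedModule.smul_mem_of_lie_mem (hat g) (Q := N.toSubmodule)
      (fun x z hz => N.lie_mem hz) u hw

end AffineKM

/-! ### Detecting vectors of the induced module -/

namespace InducedModule

attribute [local instance 100] LieRing.ofAssociativeRing

variable {R : Type*} {L : Type*} {M : Type*} [CommRing R] [LieRing L] [LieAlgebra R L]
  (S : LieSubalgebra R L) [AddCommGroup M] [Module R M] [LieRingModule S M]

/-- Half of Frobenius reciprocity: the `S`-equivariant `κ` extends to `u ⊗ w ↦ A(u) (κ w)`, which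
respects the defining relations. -/
theorem eq_zero_of_mk_one_eq_zero {F : Type*} [AddCommGroup F] [Module R F]
    (A : L →ₗ⁅R⁆ Module.End R F) (κ : M →ₗ[R] F) (hκ : ∀ (s : S) (w : M), A s (κ w) = κ ⁅s, w⁆)
    {w : M} (hw : mk S 1 w = 0) : κ w = 0 := by
  let A' := UniversalEnvelopingAlgebra.lift R A
  let Ψ : UniversalEnvelopingAlgebra R L ⊗[R] M →ₗ[R] F :=
    TensorProduct.lift ((LinearMap.lcomp R F κ) ∘ₗ A'.toLinearMap)
  have hΨ (u : UniversalEnvelopingAlgebra R L) (w : M) : Ψ (u ⊗ₜ w) = A' u (κ w) :=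
    TensorProduct.lift.tmul _ _
  have hsmul (u : UniversalEnvelopingAlgebra R L) (t : UniversalEnvelopingAlgebra R L ⊗[R] M) :
      Ψ (u • t) = A' u (Ψ t) := by
    induction t using TensorProduct.induction_on with
    | zero => rw [smul_zero, map_zero, map_zero]
    | add x y hx hy => rw [smul_add, map_add, hx, hy, map_add, map_add]
    | tmul u' w =>
      rw [TensorProduct.smul_tmul', hΨ, hΨ, smul_eq_mul, map_mul, Module.End.mul_apply]
  have hrel : ∀ t ∈ inducedRelations M S, Ψ t = 0 := by
    intro t ht
    induction ht using Submodule.span_induction with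
    | mem t ht =>
      obtain ⟨s, w, rfl⟩ := ht
      rw [map_sub, hΨ, hΨ, UniversalEnvelopingAlgebra.lift_ι_apply, map_one, hκ,
        Module.End.one_apply, sub_self]
    | zero => exact map_zero _
    | add x y _ _ hx hy => rw [map_add, hx, hy, add_zero]
    | smul u t _ ht => rw [hsmul, ht, map_zero]
  have h := hrel _ ((Submodule.Quotient.mk_eq_zero _).1 hw)
  rwa [hΨ, map_one, Module.End.one_apply] at h

end InducedModule

/-! ### A model module on functions `ℤ → E` -/

namespace AffineKM

open AffineAlgebra

attribute [local instance 100] LieRing.ofAssociativeRing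

section Coinduced

variable {E : Type*} [AddCommGroup E] [Module ℂ E]

/-- The operator `F ↦ (c ↦ T (F (c - n)))` on functions `ℤ → E`. -/
def shiftOp (n : ℤ) : Module.End ℂ E →ₗ[ℂ] Module.End ℂ (ℤ → E) where
  toFun T :=
    { toFun := fun F c => T (F (c - n))
      map_add' := fun _ _ => funext fun _ => map_add T _ _
      map_smul' := fun r _ => funext fun _ => map_smul T r _ }
  map_add' _ _ := rfl
  map_smul' _ _ := rfl

theorem shiftOp_apply (n : ℤ) (T : Module.End ℂ E) (F : ℤ → E) (c : ℤ) :
    shiftOp n T F c = T (F (c - n)) := rfl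

theorem shiftOp_mul (n k : ℤ) (T T' : Module.End ℂ E) :
    shiftOp n T * shiftOp k T' = shiftOp (n + k) (T * T') := by
  ext F c
  simp only [Module.End.mul_apply, shiftOp_apply, sub_sub]

variable (E) in
/-- The operator `F ↦ (c ↦ c F c)` on functions `ℤ → E`. -/
def degreeOp : Module.End ℂ (ℤ → E) where
  toFun F c := (c : ℂ) • F c
  map_add' _ _ := funext fun _ => smul_add _ _ _
  map_smul' _ _ := funext fun _ => smul_comm _ _ _

theorem degreeOp_apply (F : ℤ → E) (c : ℤ) : degreeOp E F c = (c : ℂ) • F c := rfl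

variable {g : Type u} [LieRing g] [LieAlgebra ℂ g] (T : Loop g →ₗ[ℂ] Module.End ℂ E)

/-- The operators `(x ⊗ t ^ n) F = (c ↦ T (x ⊗ t ^ n) (F (c - n)))` on functions `ℤ → E`. -/
def loopShiftOp : Loop g →ₗ[ℂ] Module.End ℂ (ℤ → E) :=
  (Finsupp.lsum ℂ fun n : ℤ => shiftOp n ∘ₗ T ∘ₗ
    (TensorProduct.mk ℂ (AddMonoidAlgebra ℂ ℤ) g (AddMonoidAlgebra.single n 1) :
      g →ₗ[ℂ] LieAlgebra.loopAlgebra ℂ ℤ g)) ∘ₗ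
  (LieAlgebra.LoopAlgebra.toFinsupp ℂ ℤ g).toLinearMap

theorem loopShiftOp_mono (x : g) (n : ℤ) :
    loopShiftOp T (loopMono x n) = shiftOp n (T (loopMono x n)) := by
  change Finsupp.lsum ℂ (fun n : ℤ => shiftOp n ∘ₗ T ∘ₗ
      (TensorProduct.mk ℂ (AddMonoidAlgebra ℂ ℤ) g (AddMonoidAlgebra.single n 1) :
        g →ₗ[ℂ] LieAlgebra.loopAlgebra ℂ ℤ g))
    (LieAlgebra.LoopAlgebra.toFinsupp ℂ ℤ g (AddMonoidAlgebra.single n (1 : ℂ) ⊗ₜ[ℂ] x)) = _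
  rw [LieAlgebra.LoopAlgebra.toFinsupp_single_tmul, Finsupp.lsum_single]
  rfl

/-- The operator of `x ⊗ t ^ n` shifts the argument by `n`, so its commutator with multiplication by
the argument is `n` times itself. -/
theorem loopShiftOp_degree (z : Loop g) :
    loopShiftOp T (loopDegree g z)
      = degreeOp E * loopShiftOp T z - loopShiftOp T z * degreeOp E := by
  induction z using loop_induction with
  | h0 => simp
  | hadd y z hy hz => rw [map_add, map_add, hy, hz, map_add, mul_add, add_mul]; abel
  | hmono x n =>
    rw [loopDegree_mono, map_smul, loopShiftOp_mono]
    ext F c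
    simp only [LinearMap.smul_apply, LinearMap.sub_apply, Module.End.mul_apply, Pi.smul_apply,
      Pi.sub_apply, shiftOp_apply, degreeOp_apply, map_smul, ← sub_smul]
    congr 1
    push_cast
    ring

/-- Constant functions do not see the shift, so they carry the original action `T`. -/
theorem loopShiftOp_const (z : Loop g) (w : E) :
    loopShiftOp T z (Function.const ℤ w) = Function.const ℤ (T z w) := by
  induction z using loop_induction with
  | h0 => simp only [map_zero]; rfl
  | hadd y z hy hz => rw [map_add, LinearMap.add_apply, hy, hz, map_add]; rfl
  | hmono x n => rw [loopShiftOp_mono]; rfl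

theorem loopShiftOp_lie (hT : ∀ y z, T ⁅y, z⁆ = T y * T z - T z * T y) (y z : Loop g) :
    loopShiftOp T ⁅y, z⁆
      = loopShiftOp T y * loopShiftOp T z - loopShiftOp T z * loopShiftOp T y := by
  induction y using loop_induction with
  | h0 => simp
  | hadd y y' hy hy' => rw [add_lie, map_add, hy, hy', map_add, mul_add, add_mul]; abel
  | hmono x n =>
    induction z using loop_induction with
    | h0 => simp
    | hadd z z' hz hz' => rw [lie_add, map_add, hz, hz', map_add, mul_add, add_mul]; abel
    | hmono y k =>
      rw [loopMono_lie, loopShiftOp_mono, loopShiftOp_mono, loopShiftOp_mono, shiftOp_mul,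
        shiftOp_mul, ← loopMono_lie, hT, map_sub, add_comm k n]

/-- The action of the affine algebra on functions `ℤ → E`, where `d` multiplies by the argument
and `K` acts as zero. -/
def coinducedAction (hT : ∀ y z, T ⁅y, z⁆ = T y * T z - T z * T y) :
    AffineAlgebra g →ₗ⁅ℂ⁆ Module.End ℂ (ℤ → E) where
  toLinearMap := loopShiftOp T ∘ₗ loopPart + degreeCoeff.smulRight (degreeOp E)
  map_lie' {x y} := by
    change loopShiftOp T (loopPart ⁅x, y⁆) + degreeCoeff ⁅x, y⁆ • degreeOp E
      = ⁅loopShiftOp T (loopPart x) + degreeCoeff x • degreeOp E,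
        loopShiftOp T (loopPart y) + degreeCoeff y • degreeOp E⁆
    rw [loopPart_lie, degreeCoeff_lie, zero_smul, add_zero, map_sub, map_add, map_smul, map_smul,
      loopShiftOp_lie T hT, loopShiftOp_degree, loopShiftOp_degree, Ring.lie_def]
    simp only [add_mul, mul_add, smul_mul_assoc, mul_smul_comm]
    module

theorem coinducedAction_apply (hT : ∀ y z, T ⁅y, z⁆ = T y * T z - T z * T y)
    (x : AffineAlgebra g) :
    coinducedAction T hT x = loopShiftOp T (loopPart x) + degreeCoeff x • degreeOp E := rfl

end Coinduced

/-! ### The evaluation module embeds in the induced module -/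

section Nontrivial

variable {g : Type u} [LieRing g] [LieAlgebra ℂ g] {m : ℕ} (a : Fin m → ℂˣ) (V : Fin m → Type v)
  [∀ i, AddCommGroup (V i)] [∀ i, Module ℂ (V i)]
  [∀ i, LieRingModule g (V i)] [∀ i, LieModule ℂ g (V i)]

/-- The action of the loop algebra on the evaluation module. -/
def loopEvalOp : Loop g →ₗ[ℂ] Module.End ℂ (⨂[ℂ] j, V j) :=
  evalOp V a ∘ₗ ofLoop.codRestrict (hat g).toSubmodule ofLoop_mem_hat

theorem evalOp_eq_loopEvalOp (s : hat g) :
    evalOp V a s = loopEvalOp a V (loopPart (s : AffineAlgebra g)) :=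
  (evalOp_apply V a s).trans (evalOp_apply V a ⟨_, ofLoop_mem_hat _⟩).symm

theorem loopEvalOp_lie (y z : Loop g) :
    loopEvalOp a V ⁅y, z⁆
      = loopEvalOp a V y * loopEvalOp a V z - loopEvalOp a V z * loopEvalOp a V y := by
  have h := evalOp_lie V a ⟨_, ofLoop_mem_hat y⟩ ⟨_, ofLoop_mem_hat z⟩
  rw [evalOp_eq_loopEvalOp] at h
  refine Eq.trans ?_ h
  congr 1
  change _ = ⁅y, z⁆ + (0 : ℂ) • loopDegree g z - (0 : ℂ) • loopDegree g y
  rw [zero_smul, zero_smul, add_zero, sub_zero]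

/-- The inclusion of `E` as constant functions is `hat g`-equivariant and injective, so no vector of
`E` can die in the induced module. -/
theorem polyMk_one_injective : Function.Injective (polyMk (g := g) a V 1) := by
  refine (injective_iff_map_eq_zero _).2 fun w hw => ?_
  rw [polyMk_apply, map_one] at hw
  let κ : EvalModule a V →ₗ[ℂ] ℤ → ⨂[ℂ] j, V j :=
    { toFun := fun w => Function.const ℤ w
      map_add' := fun _ _ => rfl
      map_smul' := fun _ _ => rfl }
  have h := InducedModule.eq_zero_of_mk_one_eq_zero (hat g)
    (coinducedAction (loopEvalOp a V) (loopEvalOp_lie a V)) κ (fun s w => ?_) hw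
  · exact congr_fun h 0
  · have hs : degreeCoeff (s : AffineAlgebra g) = 0 := s.2
    rw [coinducedAction_apply, hs, zero_smul, add_zero]
    refine (loopShiftOp_const (loopEvalOp a V) _ w).trans ?_
    rw [← evalOp_eq_loopEvalOp]
    rfl

end Nontrivial

end AffineKM

end

theorem corollary3p5 {g : Type u} [LieRing g] [LieAlgebra ℂ g] [FiniteDimensional ℂ g]
    [LieAlgebra.IsSimple ℂ g] (H : LieSubalgebra ℂ g) [H.IsCartanSubalgebra]
    (b : (LieAlgebra.IsKilling.rootSystem H).Base)
    (m : ℕ) (a : Fin m → ℂˣ) (ha : Function.Injective a)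
    (lam : Fin m → Module.Dual ℂ H) (hlam : lam ≠ 0)
    (V : Fin m → Type v) [∀ i, AddCommGroup (V i)] [∀ i, Module ℂ (V i)]
    [∀ i, LieRingModule g (V i)] [∀ i, LieModule ℂ g (V i)]
    (hV : ∀ i, IsIrreducibleHighestWeightModule b (lam i) (V i)) :
    LieModule.IsIrreducible ℂ (AffineAlgebra g)
      (InducedModule (AffineKM.EvalModule a V) (AffineAlgebra.hat g)) := by
  have : ∀ i, LieModule.IsIrreducible ℂ g (V i) := fun i => (hV i).irreducible
  choose u hu using fun i => (hV i).highestWeight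
  have : Nontrivial (InducedModule (AffineKM.EvalModule a V) (AffineAlgebra.hat g)) := by
    refine ⟨AffineKM.polyMk a V 1 (PiTensorProduct.tprod ℂ u), 0, fun h => ?_⟩
    exact tprod_ne_zero V (fun i => (hu i).1.ne_zero)
      ((map_eq_zero_iff _ (AffineKM.polyMk_one_injective a V)).1 h)
  obtain ⟨i, hi⟩ := Function.ne_iff.1 hlam
  obtain ⟨h, hh⟩ : ∃ h, lam i h ≠ 0 := by
    by_contra! h0
    exact hi (LinearMap.ext h0)
  -- This is where `lam ≠ 0` enters: some factor is not a trivial `g`-module.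
  have hv : ⁅(h : g), u i⁆ ≠ 0 := by
    rw [(hu i).1.weight h]
    exact smul_ne_zero hh (hu i).1.ne_zero
  exact LieModule.IsIrreducible.mk (AffineKM.eq_top_of_ne_bot ha hv)
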